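/- Let $f:\mathbb{R}^d\to\mathbb{R}$ be differentiable and strictly convex with a minimizer $x^\star$, and put $f_\star=f(x^\star)$. Let $\phi:\mathbb{R}^d\to\mathbb{R}$ be a positive-definite quadratic function, i.e. $\phi(x)=L(x,x)$ for a symmetric bilinear form $L$ with $L(x,x)>0$ for all $x\neq 0$. For a sequence $\boldsymbol{x}=(x_t)_{t\ge 0}$ in $\mathbb{R}^d$ write $\Delta x_t=x_{t+1}-x_t$ and define its infinite-horizon regret $$\mathcal{R}_\infty(\boldsymbol{x})=\sum_{t=1}^{\infty}\bigl(f(x_t)-f_\star+\phi(\Delta x_{t-1})\bigr)\in[0,\infty],$$ and let $J^\infty(x)=\inf\{\mathcal{R}_\infty(\boldsymbol{y}) : y_0=x\}$ be the associated value function. Let $\boldsymbol{x}$ be regret-optimal, i.e. a minimizer of $\mathcal{R}_\infty$ among all sequences with the same initial point $x_0$. Suppose that $J^\infty$ is $\lambda$-relatively-smooth with respect to $\phi$ for some $\lambda>0$, i.e. $\lambda\phi-J^\infty$ is convex. Then $$f(x_t)-f_\star+\phi(\Delta x_t)\le\frac{2\lambda\,\phi(x_0-x^\star)}{t^2}$$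 for all but finitely many $t\in\mathbb{N}$. If, in addition, $J^\infty$ is $\mu$-relatively-convex with respect to $\phi$ for some $\mu>0$, i.e. $J^\infty-\mu\phi$ is convex, then $$f(x_t)-f_\star+\phi(\Delta x_t)\le\lambda\,\phi(x_0-x^\star)\left(1-\frac{2\mu}{1+\mu}\right)^{t+1}$$ for all but finitely many $t\in\mathbb{N}$. -/

import Mathlib

namespace RegretOpt

/-- The optimization domain `ℝ^d` with its Euclidean norm. -/
abbrev X (d : ℕ) : Type := EuclideanSpace ℝ (Fin d)

/-- The optimal value of the objective. It is only used for objectives that have a minimizer. -/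
noncomputable def optValue {d : ℕ} (f : X d → ℝ) : ℝ := ⨅ y, f y

/-- The algorithms (sequences of iterates) that start at `x₀`. -/
def algorithms {d : ℕ} (x₀ : X d) : Set (ℕ → X d) := {x | x 0 = x₀}

/-- The infinite-horizon regret `∑_{t ≥ 1} (f(x_t) - f⋆ + φ(x_t - x_{t-1}))`, with values in
`[0, ∞]`. For `φ ≥ 0` and an objective with a minimizer all the summands are nonnegative, so that
`ENNReal.ofReal` does not truncate. -/
noncomputable def regret {d : ℕ} (f φ : X d → ℝ) (x : ℕ → X d) : ENNReal :=
  ∑' t : ℕ, ENNReal.ofReal (f (x (t + 1)) - optValue f + φ (x (t + 1) - x t))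

/-- The asymptotically regret-optimal algorithms started at `x₀`: the minimizers of the
infinite-horizon regret among all sequences that start at `x₀`. -/
def regretOptimal {d : ℕ} (f φ : X d → ℝ) (x₀ : X d) : Set (ℕ → X d) :=
  {x | x ∈ algorithms x₀ ∧ ∀ y ∈ algorithms x₀, regret f φ x ≤ regret f φ y}

/-- The infinite-horizon value function, the least regret of a sequence started at `x₀`.
By `iInf_regret_ne_top` below the infimum is finite, so `ENNReal.toReal` loses nothing. -/
noncomputable def valueFunction {d : ℕ} (f φ : X d → ℝ) (x₀ : X d) : ℝ :=
  (⨅ y ∈ algorithms x₀, regret f φ y).toReal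

/-- `g` is `c`-relatively-smooth with respect to `h`: `c h - g` is convex. -/
def RelativelySmooth {d : ℕ} (c : ℝ) (g h : X d → ℝ) : Prop :=
  ConvexOn ℝ Set.univ (fun x => c * h x - g x)

/-- `g` is `c`-relatively-convex with respect to `h`: `g - c h` is convex. -/
def RelativelyConvex {d : ℕ} (c : ℝ) (g h : X d → ℝ) : Prop :=
  ConvexOn ℝ Set.univ (fun x => g x - c * h x)

/-- `g` is a positive-definite quadratic function: `g x = L x x` for a symmetric bilinear form `L`
with `L x x > 0` for all `x ≠ 0`. -/
def IsPosDefQuadratic {d : ℕ} (g : X d → ℝ) : Prop :=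
  ∃ L : X d →ₗ[ℝ] X d →ₗ[ℝ] ℝ,
    (∀ x y, L x y = L y x) ∧ (∀ x, x ≠ 0 → 0 < L x x) ∧ ∀ x, g x = L x x

/-- The value function is finite: jumping to a minimizer and staying there has finite regret. -/
theorem iInf_regret_ne_top {d : ℕ} (f φ : X d → ℝ) (hφ : φ 0 = 0) (xs : X d)
    (hxs : IsMinOn f Set.univ xs) (x₀ : X d) :
    (⨅ y ∈ algorithms x₀, regret f φ y) ≠ ⊤ := by
  have hopt : optValue f = f xs := by
    have hle : ∀ y, f xs ≤ f y := fun y => hxs (Set.mem_univ y)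
    exact le_antisymm (ciInf_le ⟨f xs, by rintro _ ⟨y, rfl⟩; exact hle y⟩ xs) (le_ciInf hle)
  let y : ℕ → X d := fun t => if t = 0 then x₀ else xs
  have hy : y ∈ algorithms x₀ := by simp [algorithms, y]
  refine ne_top_of_le_ne_top ?_ (iInf₂_le y hy)
  have hz : ∀ t, t ≠ 0 →
      ENNReal.ofReal (f (y (t + 1)) - optValue f + φ (y (t + 1) - y t)) = 0 := by
    intro t ht
    simp [y, ht, hφ, hopt]
  rw [regret, tsum_eq_single 0 hz]
  exact ENNReal.ofReal_ne_top

end RegretOpt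

namespace RegretOpt

/-! ### Rates for Bellman trajectories on a real vector space with a positive semidefinite form. -/

section Abstract

variable {E : Type*} [AddCommGroup E] [Module ℝ E]

/-! By dynamic programming, `x (t + 1)` is the prox point of `g + J` at `x t`, where `g = f - f⋆`;
the optimal value is `J (x t)`. Let `D t` be the squared `L`-distance to the minimizer `e` and `r t`
the regret of step `t`.

Sublinear rate: `r t = J (x t) - J (x (t + 1))` and `J (x t) ≤ D t - D (t + 1)`. Both `r` and `J (x
t)` decrease, so telescoping twice gives `m² * r (3m) ≤ D m - D (2m)`. As `D` converges, the right
side vanishes: `r t = o(1/t²)`, which absorbs any constant.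

Linear rate: strong convexity of `J`, tested against the jump to `e`, gives `D (t + 1) ≤ (1 - mu)² *
D t` (`dist_succ_le`). This beats the claimed ratio by the factor `1 - mu²`, whose powers again
absorb the constant. -/

theorem le_of_forall_le_add_mul {a b k : ℝ} (h : ∀ s : ℝ, 0 < s → s < 1 → a ≤ b + s * k) :
    a ≤ b := by
  have ht : Filter.Tendsto (fun s : ℝ => b + s * k) (nhdsWithin 0 (Set.Ioi 0)) (nhds b) := by
    have : Filter.Tendsto (fun s : ℝ => b + s * k) (nhds 0) (nhds (b + 0 * k)) :=
      (by fun_prop : Continuous fun s : ℝ => b + s * k).tendsto 0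
    rw [zero_mul, add_zero] at this
    exact this.mono_left nhdsWithin_le_nhds
  refine ge_of_tendsto ht ?_
  filter_upwards [Ioo_mem_nhdsGT (zero_lt_one (α := ℝ))] with s hs
  exact h s hs.1 hs.2

/-- A minimizer of a strongly convex function has quadratic growth. -/
theorem quadratic_growth (L : E →ₗ[ℝ] E →ₗ[ℝ] ℝ) (hL : ∀ x y, L x y = L y x) (F : E → ℝ)
    (c : ℝ) (hF : ConvexOn ℝ Set.univ (fun y => F y - c * L y y)) (u : E)
    (hu : ∀ y, F u ≤ F y) (y : E) : F u + c * L (y - u) (y - u) ≤ F y := by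
  -- Compare `u` with the point at parameter `s` on the segment to `y`, divide by `s`, let `s → 0`.
  refine le_of_forall_le_add_mul (k := c * L (y - u) (y - u)) fun s hs hs1 => ?_
  have h := hF.2 (Set.mem_univ u) (Set.mem_univ y) (sub_nonneg.2 hs1.le) hs.le (by ring)
  have hm := hu ((1 - s) • u + s • y)
  have hyu := hL y u
  simp only [map_add, map_sub, map_smul, LinearMap.add_apply, LinearMap.sub_apply,
    LinearMap.smul_apply, smul_eq_mul] at h hm ⊢
  refine le_of_mul_le_mul_left ?_ hs
  rw [hyu] at h ⊢
  linarith

/-- Cauchy–Schwarz in the form in which it is used for prox steps. -/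
theorem apply_self_le_of_apply_self_le_apply (L : E →ₗ[ℝ] E →ₗ[ℝ] ℝ)
    (hL : ∀ x y, L x y = L y x) (hpos : ∀ x, 0 ≤ L x x) {p q : E} (h : L q q ≤ L p q) :
    L q q ≤ L p p := by
  have h1 := hpos (p - q)
  have hpq := hL p q
  simp only [map_sub, LinearMap.sub_apply] at h1
  linarith

/-- A cost `g` and a function `J` with a common zero `e` that satisfy the Bellman inequality for
the transition cost `L (y - z) (y - z)`, with equality along the trajectory `x`. -/
structure IsBellmanTrajectory (L : E →ₗ[ℝ] E →ₗ[ℝ] ℝ) (g J : E → ℝ) (e : E) (x : ℕ → E) :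
    Prop where
  symm : ∀ x y, L x y = L y x
  pos : ∀ x, 0 ≤ L x x
  convex_cost : ConvexOn ℝ Set.univ g
  convex_value : ConvexOn ℝ Set.univ J
  cost_nonneg : ∀ y, 0 ≤ g y
  value_nonneg : ∀ y, 0 ≤ J y
  cost_eq : g e = 0
  value_eq : J e = 0
  le : ∀ z y, J z ≤ g y + L (y - z) (y - z) + J y
  eq : ∀ t, J (x t) = g (x (t + 1)) + L (x (t + 1) - x t) (x (t + 1) - x t) + J (x (t + 1))

namespace IsBellmanTrajectory

variable {L : E →ₗ[ℝ] E →ₗ[ℝ] ℝ} {g J : E → ℝ} {e : E} {x : ℕ → E}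

/-- Quadratic growth of the prox objective around its minimizer `x (t + 1)`. -/
theorem prox_le (h : IsBellmanTrajectory L g J e x) (t : ℕ) (y : E) :
    J (x t) + L (y - x (t + 1)) (y - x (t + 1)) ≤ g y + L (y - x t) (y - x t) + J y := by
  have hc : ConvexOn ℝ Set.univ
      (fun y => (g y + L (y - x t) (y - x t) + J y) - 1 * L y y) := by
    refine ⟨convex_univ, fun y _ z _ a b ha hb hab => ?_⟩
    have h1 := h.convex_cost.2 (Set.mem_univ y) (Set.mem_univ z) ha hb hab
    have h2 := h.convex_value.2 (Set.mem_univ y) (Set.mem_univ z) ha hb hab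
    have e1 := h.symm (x t) y
    have e2 := h.symm (x t) z
    obtain rfl : b = 1 - a := by linarith
    simp only [map_add, map_sub, map_smul, LinearMap.add_apply, LinearMap.sub_apply,
      LinearMap.smul_apply, smul_eq_mul] at h1 h2 ⊢
    rw [e1, e2]
    linarith
  have := quadratic_growth L h.symm _ 1 hc (x (t + 1))
    (fun z => (h.eq t).symm.trans_le (h.le (x t) z)) y
  have h2 := h.eq t
  linarith

theorem dist_add_value_le (h : IsBellmanTrajectory L g J e x) (t : ℕ) :
    L (x (t + 1) - e) (x (t + 1) - e) + J (x t) ≤ L (x t - e) (x t - e) := by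
  have h1 := h.prox_le t e
  rw [h.cost_eq, h.value_eq, ← neg_sub (x t) e, ← neg_sub (x (t + 1)) e] at h1
  simp only [map_neg, LinearMap.neg_apply, neg_neg] at h1
  linarith

/-- Firm nonexpansiveness of the prox map: add two consecutive prox inequalities, each tested at the
other's prox point. -/
theorem apply_step_step (h : IsBellmanTrajectory L g J e x) (t : ℕ) :
    L (x (t + 2) - x (t + 1)) (x (t + 2) - x (t + 1)) ≤
      L (x (t + 1) - x t) (x (t + 2) - x (t + 1)) := by
  have h1 := h.prox_le t (x (t + 2))
  have h2 := h.prox_le (t + 1) (x (t + 1))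
  have e1 := h.eq t
  have e2 := h.eq (t + 1)
  have s1 := h.symm (x t) (x (t + 1))
  have s2 := h.symm (x t) (x (t + 2))
  have s3 := h.symm (x (t + 1)) (x (t + 2))
  simp only [add_assoc, Nat.reduceAdd, map_sub, LinearMap.sub_apply] at *
  linarith

theorem step_antitone (h : IsBellmanTrajectory L g J e x) (t : ℕ) :
    L (x (t + 2) - x (t + 1)) (x (t + 2) - x (t + 1)) ≤
      L (x (t + 1) - x t) (x (t + 1) - x t) :=
  apply_self_le_of_apply_self_le_apply L h.symm h.pos (h.apply_step_step t)

/-- With its neighbours fixed, `x (t + 1)` minimizes the two-step cost, which is 2-strongly convex.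
Testing at `x t`, the parallelogram law and `step_antitone` remove the quadratic terms. -/
theorem cost_antitone (h : IsBellmanTrajectory L g J e x) (t : ℕ) :
    g (x (t + 1)) ≤ g (x t) := by
  have hc : ConvexOn ℝ Set.univ (fun y =>
      (g y + L (y - x t) (y - x t) + L (x (t + 2) - y) (x (t + 2) - y)) - 2 * L y y) := by
    refine ⟨convex_univ, fun y _ z _ a b ha hb hab => ?_⟩
    have h1 := h.convex_cost.2 (Set.mem_univ y) (Set.mem_univ z) ha hb hab
    have e1 := h.symm (x t) y
    have e2 := h.symm (x t) z
    have e3 := h.symm (x (t + 2)) y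
    have e4 := h.symm (x (t + 2)) z
    obtain rfl : b = 1 - a := by linarith
    simp only [map_add, map_sub, map_smul, LinearMap.add_apply, LinearMap.sub_apply,
      LinearMap.smul_apply, smul_eq_mul] at h1 ⊢
    rw [e1, e2, e3, e4]
    linarith
  have hmin := quadratic_growth L h.symm _ 2 hc (x (t + 1)) (fun z => by
    have h1 := h.le (x t) z
    have h2 := h.le z (x (t + 2))
    have e1 := h.eq t
    have e2 := h.eq (t + 1)
    simp only [add_assoc, Nat.reduceAdd] at *
    linarith) (x t)
  have h1 := h.step_antitone t
  have h2 := h.pos ((x (t + 1) - x t) - (x (t + 2) - x (t + 1)))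
  have s1 := h.symm (x t) (x (t + 1))
  have s2 := h.symm (x t) (x (t + 2))
  have s3 := h.symm (x (t + 1)) (x (t + 2))
  simp only [map_sub, LinearMap.sub_apply] at *
  linarith

theorem dist_antitone (h : IsBellmanTrajectory L g J e x) :
    Antitone fun t => L (x t - e) (x t - e) :=
  antitone_nat_of_succ_le fun t => by
    have := h.dist_add_value_le t
    have := h.value_nonneg (x t)
    linarith

theorem value_antitone (h : IsBellmanTrajectory L g J e x) : Antitone fun t => J (x t) :=
  antitone_nat_of_succ_le fun t => by
    have := h.eq t
    have := h.cost_nonneg (x (t + 1))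
    have := h.pos (x (t + 1) - x t)
    linarith

theorem regret_antitone (h : IsBellmanTrajectory L g J e x) :
    Antitone fun t => g (x (t + 1)) + L (x (t + 1) - x t) (x (t + 1) - x t) :=
  antitone_nat_of_succ_le fun t => add_le_add (h.cost_antitone (t + 1)) (h.step_antitone t)

/-- If the decrements of `u` dominate an antitone sequence `b`, then `m * b (n + m)` is at most
the decrement over `m` steps. -/
theorem mul_le_sub_of_antitone {b u : ℕ → ℝ} (hb : Antitone b)
    (hu : ∀ t, b t ≤ u t - u (t + 1)) (n m : ℕ) : m * b (n + m) ≤ u n - u (n + m) := by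
  induction m with
  | zero => simp
  | succ m ih =>
    have h1 : b (n + (m + 1)) ≤ b (n + m) := hb (by omega)
    have h2 := hu (n + m)
    have h3 : (m : ℝ) * b (n + (m + 1)) ≤ m * b (n + m) :=
      mul_le_mul_of_nonneg_left h1 m.cast_nonneg
    rw [← add_assoc] at *
    push_cast
    linarith

theorem sq_mul_regret_le (h : IsBellmanTrajectory L g J e x) (m : ℕ) :
    (m : ℝ) ^ 2 * (g (x (3 * m + 1)) +
      L (x (3 * m + 1) - x (3 * m)) (x (3 * m + 1) - x (3 * m))) ≤
      L (x m - e) (x m - e) - L (x (2 * m) - e) (x (2 * m) - e) := by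
  have h1 := mul_le_sub_of_antitone h.regret_antitone (u := fun t => J (x t))
    (fun t => by have := h.eq t; linarith) (2 * m) m
  have h2 := mul_le_sub_of_antitone h.value_antitone (u := fun t => L (x t - e) (x t - e))
    (fun t => by have := h.dist_add_value_le t; linarith) m m
  have h3 := h.value_nonneg (x (2 * m + m))
  rw [← two_mul] at h2
  have e3 : 2 * m + m = 3 * m := by ring
  rw [e3] at h1 h3
  have h4 := mul_le_mul_of_nonneg_left (h1.trans (sub_le_self _ h3)) m.cast_nonneg (α := ℝ)
  rw [sq, mul_assoc]
  exact h4.trans h2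

/-- Passes from the incoming step, which the regret charges, to the outgoing step of the final
bounds. -/
theorem succ_le_regret (h : IsBellmanTrajectory L g J e x) (t : ℕ) :
    g (x (t + 1)) + L (x (t + 2) - x (t + 1)) (x (t + 2) - x (t + 1)) ≤
      g (x (t + 1)) + L (x (t + 1) - x t) (x (t + 1) - x t) :=
  add_le_add_right (h.step_antitone t) _

theorem regret_le_dist (h : IsBellmanTrajectory L g J e x) (t : ℕ) :
    g (x (t + 1)) + L (x (t + 1) - x t) (x (t + 1) - x t) ≤ L (x t - e) (x t - e) := by
  have h1 := h.eq t
  have h2 := h.dist_add_value_le t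
  have h3 := h.value_nonneg (x (t + 1))
  have h4 := h.pos (x (t + 1) - e)
  linarith

/-- The sublinear rate, with any positive constant. -/
theorem eventually_le_div_sq (h : IsBellmanTrajectory L g J e x) {C : ℝ} (hC : 0 < C) :
    ∀ᶠ t : ℕ in Filter.atTop,
      g (x t) + L (x (t + 1) - x t) (x (t + 1) - x t) ≤
        C * L (x 0 - e) (x 0 - e) / (t : ℝ) ^ 2 := by
  rcases (h.pos (x 0 - e)).eq_or_lt with h0 | h0
  · filter_upwards [Filter.eventually_ge_atTop 1] with t ht
    obtain ⟨t, rfl⟩ := Nat.exists_eq_add_of_le' ht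
    have := (h.succ_le_regret t).trans ((h.regret_le_dist t).trans (h.dist_antitone t.zero_le))
    rw [← h0, mul_zero, zero_div]
    exact this.trans_eq h0.symm
  · obtain ⟨l, hl⟩ : ∃ l, Filter.Tendsto (fun t => L (x t - e) (x t - e)) Filter.atTop (nhds l) :=
      ⟨_, tendsto_atTop_ciInf h.dist_antitone ⟨0, by rintro _ ⟨t, rfl⟩; exact h.pos _⟩⟩
    -- With `m = (t - 1) / 3`, one has `3m + 1 ≤ t ≤ 6m` for `t ≥ 4`; hence the constant `36`.
    have hm : Filter.Tendsto (fun t : ℕ => (t - 1) / 3) Filter.atTop Filter.atTop :=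
      Filter.tendsto_atTop_atTop.2 fun b => ⟨3 * b + 1, fun t ht => by omega⟩
    have h2m : Filter.Tendsto (fun t : ℕ => 2 * ((t - 1) / 3)) Filter.atTop Filter.atTop :=
      Filter.tendsto_atTop_atTop.2 fun b => ⟨3 * b + 1, fun t ht => by omega⟩
    have hd := (hl.comp hm).sub (hl.comp h2m)
    rw [sub_self] at hd
    have hev := hd.eventually (eventually_le_nhds
      (show (0 : ℝ) < C * L (x 0 - e) (x 0 - e) / 36 by positivity))
    filter_upwards [hev, Filter.eventually_ge_atTop 4] with t ht ht4
    simp only [Function.comp] at ht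
    have hb := h.sq_mul_regret_le ((t - 1) / 3)
    have hmon := h.regret_antitone (show 3 * ((t - 1) / 3) ≤ t - 1 by omega)
    have hs := h.succ_le_regret (t - 1)
    have htm : (t : ℝ) ≤ 6 * ((t - 1) / 3 : ℕ) := by
      exact_mod_cast (show t ≤ 6 * ((t - 1) / 3) by omega)
    rw [show t - 1 + 2 = t + 1 by omega, show t - 1 + 1 = t by omega] at hs
    simp only [show t - 1 + 1 = t by omega] at hmon
    set m : ℝ := (((t - 1) / 3 : ℕ) : ℝ)
    have ht0 : (0 : ℝ) < t := by exact_mod_cast (by omega : 0 < t)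
    have hsq : (t : ℝ) ^ 2 ≤ 36 * m ^ 2 := by nlinarith
    have hnn : 0 ≤ g (x t) + L (x (t + 1) - x t) (x (t + 1) - x t) :=
      add_nonneg (h.cost_nonneg _) (h.pos _)
    rw [le_div_iff₀ (by positivity)]
    have k1 := mul_le_mul_of_nonneg_left hsq hnn
    have k2 := mul_le_mul_of_nonneg_left (hs.trans hmon) (sq_nonneg m)
    linarith

/-! ### Linear rate under strong convexity of the value. -/

section StronglyConvex

variable {mu : ℝ}

theorem mul_dist_le_value (h : IsBellmanTrajectory L g J e x)
    (hJ : ConvexOn ℝ Set.univ (fun y => J y - mu * L y y)) (y : E) :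
    mu * L (y - e) (y - e) ≤ J y := by
  have := quadratic_growth L h.symm J mu hJ e (fun z => h.value_eq.trans_le (h.value_nonneg z)) y
  rwa [h.value_eq, zero_add] at this

/-- The vector `2 (x t - x (t + 1))` represents a strong subgradient of `J` at `x t`. -/
theorem strong_subgradient (h : IsBellmanTrajectory L g J e x)
    (hJ : ConvexOn ℝ Set.univ (fun y => J y - mu * L y y)) (t : ℕ) (w : E) :
    J (x t) + 2 * L (x t - x (t + 1)) w + mu * L w w ≤ J (x t + w) := by
  -- Moving from `x t - s • w` to `x (t + 1)` bounds `J` above by a quadratic touching it at `x t`.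
  -- Convexity between `x t - s • w` and `x t + w` turns its slope into a lower bound as `s → 0`.
  refine le_of_forall_le_add_mul (k := (1 - mu) * L w w) fun s hs _ => ?_
  have hs' : 0 < 1 + s := by linarith
  have hc := hJ.2 (Set.mem_univ (x t + w)) (Set.mem_univ (x t - s • w))
    (div_nonneg hs.le hs'.le) (div_nonneg zero_le_one hs'.le) (by field_simp; ring)
  have hx : (s / (1 + s)) • (x t + w) + (1 / (1 + s)) • (x t - s • w) = x t := by
    have : s / (1 + s) + 1 / (1 + s) = 1 := by field_simp; ring
    rw [smul_add, smul_sub, smul_smul, one_div_mul_eq_div]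
    calc _ = (s / (1 + s) + 1 / (1 + s)) • x t := by rw [add_smul]; abel
      _ = x t := by rw [this, one_smul]
  rw [hx] at hc
  have hc' : (1 + s) * (J (x t) - mu * L (x t) (x t)) ≤
      s * (J (x t + w) - mu * L (x t + w) (x t + w)) +
        (J (x t - s • w) - mu * L (x t - s • w) (x t - s • w)) := by
    have := mul_le_mul_of_nonneg_left hc hs'.le
    refine this.trans_eq ?_
    simp only [smul_eq_mul]
    field_simp
  have hb := h.le (x t - s • w) (x (t + 1))
  have he := h.eq t
  have e1 := h.symm w (x t)
  have e2 := h.symm w (x (t + 1))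
  have e3 := h.symm (x t) (x (t + 1))
  refine le_of_mul_le_mul_left ?_ hs
  simp only [map_add, map_sub, map_smul, LinearMap.add_apply, LinearMap.sub_apply,
    LinearMap.smul_apply, smul_eq_mul] at hc' hb he ⊢
  rw [e1] at hc' hb
  rw [e2] at hb
  linarith

theorem quadratic_nonneg (h : IsBellmanTrajectory L g J e x)
    (hJ : ConvexOn ℝ Set.univ (fun y => J y - mu * L y y)) (t : ℕ) (w : E) :
    0 ≤ (1 - mu) * L (x t - e) (x t - e) + 2 * L (x (t + 1) - e) w + (1 - mu) * L w w := by
  have h1 := h.strong_subgradient hJ t w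
  have h2 := h.mul_dist_le_value hJ (x t)
  have h3 := h.le (x t + w) e
  rw [h.cost_eq, h.value_eq] at h3
  have e1 := h.symm w (x t)
  have e2 := h.symm w e
  have e3 := h.symm (x t) e
  simp only [map_add, map_sub, LinearMap.add_apply, LinearMap.sub_apply] at *
  linarith

theorem dist_succ_le (h : IsBellmanTrajectory L g J e x)
    (hJ : ConvexOn ℝ Set.univ (fun y => J y - mu * L y y)) (t : ℕ) :
    L (x (t + 1) - e) (x (t + 1) - e) ≤ (1 - mu) ^ 2 * L (x t - e) (x t - e) := by
  have hX := h.pos (x t - e)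
  have hU := h.pos (x (t + 1) - e)
  rcases lt_or_ge mu 1 with hmu | hmu
  · have h1 := h.quadratic_nonneg hJ t (-(1 / (1 - mu)) • (x (t + 1) - e))
    have hne : 0 < 1 - mu := by linarith
    simp only [map_smul, LinearMap.smul_apply, smul_eq_mul] at h1
    have h2 := mul_nonneg hne.le h1
    refine le_of_sub_nonneg (h2.trans_eq ?_)
    field_simp
    ring
  · have h1 := h.quadratic_nonneg hJ t (-(x (t + 1) - e))
    simp only [map_neg, LinearMap.neg_apply, neg_neg] at h1
    have h2 := mul_nonneg (sq_nonneg (1 - mu)) hX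
    have h3 := mul_nonneg (sub_nonneg.2 hmu) hX
    have h4 := mul_nonneg (sub_nonneg.2 hmu) hU
    linarith

theorem dist_le_pow (h : IsBellmanTrajectory L g J e x)
    (hJ : ConvexOn ℝ Set.univ (fun y => J y - mu * L y y)) (t : ℕ) :
    L (x t - e) (x t - e) ≤ ((1 - mu) ^ 2) ^ t * L (x 0 - e) (x 0 - e) := by
  induction t with
  | zero => simp
  | succ t ih =>
    refine (h.dist_succ_le hJ t).trans ?_
    rw [pow_succ' ((1 - mu) ^ 2), mul_assoc]
    exact mul_le_mul_of_nonneg_left ih (sq_nonneg _)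

/-- The linear rate, with any positive constant. -/
theorem eventually_le_pow (h : IsBellmanTrajectory L g J e x) (hmu : 0 < mu)
    (hJ : ConvexOn ℝ Set.univ (fun y => J y - mu * L y y)) {C : ℝ} (hC : 0 < C) :
    ∀ᶠ t : ℕ in Filter.atTop,
      g (x t) + L (x (t + 1) - x t) (x (t + 1) - x t) ≤
        C * L (x 0 - e) (x 0 - e) * (1 - 2 * mu / (1 + mu)) ^ (t + 1) := by
  have hr : 1 - 2 * mu / (1 + mu) = (1 - mu) / (1 + mu) := by field_simp; ring
  have hD := h.pos (x 0 - e)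
  rw [hr]
  suffices hs : ∀ᶠ t : ℕ in Filter.atTop,
      g (x (t + 1)) + L (x (t + 2) - x (t + 1)) (x (t + 2) - x (t + 1)) ≤
        C * L (x 0 - e) (x 0 - e) * ((1 - mu) / (1 + mu)) ^ (t + 2) by
    obtain ⟨N, hN⟩ := Filter.eventually_atTop.1 hs
    refine Filter.eventually_atTop.2 ⟨N + 1, fun t ht => ?_⟩
    obtain ⟨s, rfl⟩ := Nat.exists_eq_add_of_le' (le_of_add_le_right ht)
    exact hN s (by omega)
  rcases lt_or_ge mu 1 with h1 | h1
  · have hp : 0 < 1 - mu := by linarith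
    set r := (1 - mu) / (1 + mu)
    have hr0 : 0 < r := by positivity
    have hq : (1 - mu) ^ 2 = (1 - mu ^ 2) * r := by simp only [r]; field_simp; ring
    have ht : Filter.Tendsto (fun t : ℕ => (1 - mu ^ 2) ^ t) Filter.atTop (nhds 0) :=
      tendsto_pow_atTop_nhds_zero_of_lt_one (by nlinarith) (by nlinarith)
    filter_upwards [ht.eventually (eventually_le_nhds (show 0 < C * r ^ 2 by positivity))] with t ht
    calc _ ≤ ((1 - mu) ^ 2) ^ t * L (x 0 - e) (x 0 - e) :=
          (h.succ_le_regret t).trans ((h.regret_le_dist t).trans (h.dist_le_pow hJ t))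
      _ = (1 - mu ^ 2) ^ t * (r ^ t * L (x 0 - e) (x 0 - e)) := by rw [hq, mul_pow]; ring
      _ ≤ C * r ^ 2 * (r ^ t * L (x 0 - e) (x 0 - e)) :=
          mul_le_mul_of_nonneg_right ht (by positivity)
      _ = _ := by ring
  -- For `mu ≥ 1` the distance vanishes after one step. The right side is zero too: the ratio is `0`
  -- if `mu = 1`, and `w = 0` forces `D 0 = 0` if `mu > 1`.
  · filter_upwards [Filter.eventually_ge_atTop 1] with t ht
    obtain ⟨s, rfl⟩ := Nat.exists_eq_add_of_le' ht
    have hzero : L (x (s + 1) - e) (x (s + 1) - e) ≤ 0 := by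
      refine (h.dist_antitone (show 1 ≤ s + 1 by omega)).trans ?_
      have := h.quadratic_nonneg hJ 0 (-(x 1 - e))
      simp only [map_neg, LinearMap.neg_apply, neg_neg, zero_add] at this
      have h2 := mul_nonneg (sub_nonneg.2 h1) hD
      have h3 := mul_nonneg (sub_nonneg.2 h1) (h.pos (x 1 - e))
      linarith
    refine ((h.succ_le_regret _).trans ((h.regret_le_dist _).trans hzero)).trans_eq ?_
    rcases h1.eq_or_lt with rfl | h1
    · simp
    · have hz := h.quadratic_nonneg hJ 0 0
      simp only [map_zero, mul_zero, add_zero] at hz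
      have : L (x 0 - e) (x 0 - e) = 0 := by nlinarith
      rw [this, mul_zero, zero_mul]

end StronglyConvex

end IsBellmanTrajectory

end Abstract

/-! ### Bellman equation and convexity of the value function. -/

section Value

variable {d : ℕ} {f φ : X d → ℝ}

theorem optValue_eq {xs : X d} (hxs : IsMinOn f Set.univ xs) : optValue f = f xs := by
  have hle : ∀ y, f xs ≤ f y := fun y => hxs (Set.mem_univ y)
  exact le_antisymm (ciInf_le ⟨f xs, by rintro _ ⟨y, rfl⟩; exact hle y⟩ xs) (le_ciInf hle)

/-- The value function before it is coerced to the reals. -/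
noncomputable def extendedValue (f φ : X d → ℝ) (x₀ : X d) : ENNReal :=
  ⨅ y ∈ algorithms x₀, regret f φ y

theorem regret_eq_add (x : ℕ → X d) : regret f φ x =
    ENNReal.ofReal (f (x 1) - optValue f + φ (x 1 - x 0)) + regret f φ (fun t => x (t + 1)) :=
  tsum_eq_zero_add' ENNReal.summable

theorem extendedValue_le_regret (x : ℕ → X d) : extendedValue f φ (x 0) ≤ regret f φ x :=
  iInf₂_le x (show x ∈ algorithms (x 0) from rfl)

theorem extendedValue_le (z y : X d) : extendedValue f φ z ≤
    ENNReal.ofReal (f y - optValue f + φ (y - z)) + extendedValue f φ y := by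
  simp only [extendedValue, ENNReal.add_iInf]
  refine le_iInf₂ fun x (hx : x 0 = y) => ?_
  -- Prepend `z` to a sequence from `y`.
  have h := extendedValue_le_regret (f := f) (φ := φ) (fun t => Nat.casesOn t z x)
  rw [regret_eq_add] at h
  simpa [hx, extendedValue] using h

theorem regret_eq_extendedValue {x₀ : X d} {x : ℕ → X d} (hx : x ∈ regretOptimal f φ x₀) :
    regret f φ x = extendedValue f φ (x 0) :=
  le_antisymm (le_iInf₂ fun y hy => hx.2 y (Eq.trans hy hx.1)) (extendedValue_le_regret x)

/-- Principle of optimality: the finite first cost cancels, so tails of optimal sequences are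
optimal. -/
theorem regret_shift {x : ℕ → X d}
    (hx : regret f φ x = extendedValue f φ (x 0)) (t : ℕ) :
    regret f φ (fun s => x (s + t)) = extendedValue f φ (x t) := by
  induction t with
  | zero => simpa using hx
  | succ t ih =>
    refine le_antisymm ?_ (by simpa using extendedValue_le_regret fun s => x (s + (t + 1)))
    have h1 := extendedValue_le (f := f) (φ := φ) (x t) (x (t + 1))
    rw [← ih, regret_eq_add] at h1
    simp only [zero_add, add_comm 1 t] at h1
    have h2 := (ENNReal.add_le_add_iff_left ENNReal.ofReal_ne_top).1 h1
    simpa only [add_assoc, add_comm 1 t] using h2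

/-- Convex combinations of competitors are competitors, and regret is convex termwise. -/
theorem extendedValue_convex {xs : X d} (hxs : IsMinOn f Set.univ xs)
    (hf : ConvexOn ℝ Set.univ f) (hφ : ConvexOn ℝ Set.univ φ) (hφ0 : ∀ x, 0 ≤ φ x)
    (y z : X d) {a b : ℝ} (ha : 0 ≤ a) (hb : 0 ≤ b) (hab : a + b = 1) :
    extendedValue f φ (a • y + b • z) ≤
      ENNReal.ofReal a * extendedValue f φ y + ENNReal.ofReal b * extendedValue f φ z := by
  have hopt := optValue_eq hxs
  have hle : ∀ y, f xs ≤ f y := fun y => hxs (Set.mem_univ y)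
  have key : ∀ u ∈ algorithms y, ∀ v ∈ algorithms z, extendedValue f φ (a • y + b • z) ≤
      ENNReal.ofReal a * regret f φ u + ENNReal.ofReal b * regret f φ v := by
    rintro u rfl v rfl
    refine (extendedValue_le_regret (fun t => a • u t + b • v t)).trans ?_
    simp only [regret]
    rw [← ENNReal.tsum_mul_left, ← ENNReal.tsum_mul_left, ← ENNReal.tsum_add]
    refine ENNReal.tsum_le_tsum fun t => ?_
    rw [← ENNReal.ofReal_mul ha, ← ENNReal.ofReal_mul hb, ← ENNReal.ofReal_add
      (mul_nonneg ha (add_nonneg (by rw [hopt]; exact sub_nonneg.2 (hle _)) (hφ0 _)))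
      (mul_nonneg hb (add_nonneg (by rw [hopt]; exact sub_nonneg.2 (hle _)) (hφ0 _)))]
    refine ENNReal.ofReal_le_ofReal ?_
    have h1 := hf.2 (Set.mem_univ (u (t + 1))) (Set.mem_univ (v (t + 1))) ha hb hab
    have h2 := hφ.2 (Set.mem_univ (u (t + 1) - u t)) (Set.mem_univ (v (t + 1) - v t)) ha hb hab
    have h3 : a • u (t + 1) + b • v (t + 1) - (a • u t + b • v t) =
        a • (u (t + 1) - u t) + b • (v (t + 1) - v t) := by
      rw [smul_sub, smul_sub]; abel
    rw [h3]
    obtain rfl : b = 1 - a := by linarith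
    simp only [smul_eq_mul] at h1 h2
    linarith
  have hmul : ∀ (c : ℝ) (w : X d), ENNReal.ofReal c * extendedValue f φ w =
      ⨅ u : algorithms w, ENNReal.ofReal c * regret f φ u := by
    intro c w
    have : Nonempty (algorithms w) := ⟨⟨fun _ => w, rfl⟩⟩
    rw [extendedValue, iInf_subtype', ENNReal.mul_iInf fun h => absurd h ENNReal.ofReal_ne_top]
  rw [hmul, hmul, ENNReal.iInf_add]
  refine le_iInf fun u => ?_
  rw [ENNReal.add_iInf]
  exact le_iInf fun v => key u u.2 v v.2

theorem isBellmanTrajectory_valueFunction {L : X d →ₗ[ℝ] X d →ₗ[ℝ] ℝ}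
    (hL : ∀ x y, L x y = L y x) (hpos : ∀ x, 0 ≤ L x x) (hφ : ∀ x, φ x = L x x)
    (hf : ConvexOn ℝ Set.univ f) {xs : X d} (hxs : IsMinOn f Set.univ xs)
    {x₀ : X d} {x : ℕ → X d} (hx : x ∈ regretOptimal f φ x₀) :
    IsBellmanTrajectory L (fun y => f y - optValue f) (valueFunction f φ) xs x := by
  have hopt := optValue_eq hxs
  have hle : ∀ y, 0 ≤ f y - optValue f := fun y => by
    rw [hopt]; exact sub_nonneg.2 (hxs (Set.mem_univ y))
  have hφ0 : φ 0 = 0 := by rw [hφ, map_zero]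
  have hφnn : ∀ x, 0 ≤ φ x := fun x => (hpos x).trans_eq (hφ x).symm
  have hfin : ∀ z, extendedValue f φ z ≠ ⊤ := iInf_regret_ne_top f φ hφ0 xs hxs
  have hval : ∀ z, valueFunction f φ z = (extendedValue f φ z).toReal := fun _ => rfl
  have hφc : ConvexOn ℝ Set.univ φ := by
    refine ⟨convex_univ, fun y _ z _ a b ha hb hab => ?_⟩
    have h1 := mul_nonneg (mul_nonneg ha hb) (hpos (y - z))
    have e1 := hL z y
    obtain rfl : b = 1 - a := by linarith
    simp only [hφ, map_add, map_sub, map_smul, LinearMap.add_apply, LinearMap.sub_apply,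
      LinearMap.smul_apply, smul_eq_mul] at h1 ⊢
    rw [e1] at h1 ⊢
    linarith
  refine ⟨hL, hpos, ?_, ⟨convex_univ, fun y _ z _ a b ha hb hab => ?_⟩, hle, fun y => ?_, ?_, ?_,
    fun z y => ?_, fun t => ?_⟩
  · exact hf.add_const (-optValue f)
  · have h := extendedValue_convex hxs hf hφc hφnn y z ha hb hab
    have h1 := ENNReal.mul_ne_top (ENNReal.ofReal_ne_top (r := a)) (hfin y)
    have h2 := ENNReal.mul_ne_top (ENNReal.ofReal_ne_top (r := b)) (hfin z)
    have h' := ENNReal.toReal_mono (ENNReal.add_ne_top.2 ⟨h1, h2⟩) h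
    rw [ENNReal.toReal_add h1 h2, ENNReal.toReal_mul, ENNReal.toReal_mul,
      ENNReal.toReal_ofReal ha, ENNReal.toReal_ofReal hb] at h'
    exact h'
  · exact ENNReal.toReal_nonneg
  · simp [hopt]
  · have h := extendedValue_le_regret (f := f) (φ := φ) (fun _ => xs)
    have h0 : regret f φ (fun _ => xs) = 0 := by simp [regret, hopt, hφ0]
    rw [h0, nonpos_iff_eq_zero] at h
    rw [hval, h, ENNReal.toReal_zero]
  · have h := ENNReal.toReal_mono (ENNReal.add_ne_top.2 ⟨ENNReal.ofReal_ne_top, hfin y⟩)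
      (extendedValue_le (f := f) (φ := φ) z y)
    rw [ENNReal.toReal_add ENNReal.ofReal_ne_top (hfin y),
      ENNReal.toReal_ofReal (add_nonneg (hle _) (hφnn _)), hφ] at h
    exact h
  · have hx' := regret_eq_extendedValue hx
    have h := regret_shift hx' t
    have h1 := regret_shift hx' (t + 1)
    rw [regret_eq_add] at h
    simp only [zero_add, add_assoc, add_comm 1 t] at h
    rw [h1] at h
    rw [hval, ← h, ENNReal.toReal_add ENNReal.ofReal_ne_top (hfin _),
      ENNReal.toReal_ofReal (add_nonneg (hle _) (hφnn _)), hφ, hval]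

end Value

end RegretOpt

theorem theorem14 {d : ℕ} (f φ : RegretOpt.X d → ℝ)
    (hf_diff : Differentiable ℝ f)
    (hf_conv : StrictConvexOn ℝ Set.univ f)
    (xstar : RegretOpt.X d) (hxstar : IsMinOn f Set.univ xstar)
    (hφ : RegretOpt.IsPosDefQuadratic φ)
    (lam : ℝ) (hlam : 0 < lam)
    (hsmooth : RegretOpt.RelativelySmooth lam (RegretOpt.valueFunction f φ) φ)
    (x₀ : RegretOpt.X d) (x : ℕ → RegretOpt.X d) (hx : x ∈ RegretOpt.regretOptimal f φ x₀) :
    (∀ᶠ t : ℕ in Filter.cofinite,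
      f (x t) - RegretOpt.optValue f + φ (x (t + 1) - x t)
        ≤ 2 * lam * φ (x 0 - xstar) / (t : ℝ) ^ 2) ∧
    (∀ mu : ℝ, 0 < mu → RegretOpt.RelativelyConvex mu (RegretOpt.valueFunction f φ) φ →
      ∀ᶠ t : ℕ in Filter.cofinite,
        f (x t) - RegretOpt.optValue f + φ (x (t + 1) - x t)
          ≤ lam * φ (x 0 - xstar) * (1 - 2 * mu / (1 + mu)) ^ (t + 1)) := by
  obtain ⟨L, hL, hpos, hφL⟩ := hφ
  have hpos' : ∀ x, 0 ≤ L x x := fun x => by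
    rcases eq_or_ne x 0 with rfl | hx
    · simp
    · exact (hpos x hx).le
  have h := RegretOpt.isBellmanTrajectory_valueFunction hL hpos' hφL hf_conv.convexOn hxstar hx
  simp only [RegretOpt.RelativelyConvex, Nat.cofinite_eq_atTop, hφL]
  exact ⟨h.eventually_le_div_sq (mul_pos two_pos hlam),
    fun mu hmu hJ => h.eventually_le_pow hmu hJ hlam⟩
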